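/- Let $d\ge 1$ be an integer and let $\omega:[0,\infty)\to[0,\infty)$ be a non-quasianalytic weight function, i.e. continuous and increasing (in the sense of non-decreasing), such that $(\alpha)$ there is $L\ge1$ with $\omega(2t)\le L(\omega(t)+1)$ for all $t\ge0$; $(\beta)$ $\int_1^{\infty}\omega(t)t^{-2}\,dt<\infty$; $(\gamma)$ there are $a\in\mathbb R$, $b>0$ with $\omega(t)\ge a+b\log(1+t)$ for all $t\ge0$; $(\delta)$ $t\mapsto\omega(e^t)$ is convex on $\mathbb R$. For $x\in\mathbb R^d$ write $\omega(x)=\omega(|x|)$ with $|\cdot|$ the Euclidean norm, and let $|x|_\infty=\max_j|x_j|$. Put $\hat u(\xi)=\int_{\mathbb R^d}u(x)e^{-i\langle x,\xi\rangle}\,dx$ for $u\in L^1(\mathbb R^d)$. The space $\mathcal S_\omega(\mathbb R^d)$ consists of all $u\in L^1(\mathbb R^d)$ with $u,\hat u\in C^\infty(\mathbb R^d)$ such that, for all $\lambda>0$ and all multi-indices $\alpha\in\mathbb N_0^d$, $\sup_{x}e^{\lambda\omega(x)}|D^\alpha u(x)|<\infty$ and $\sup_\xi e^{\lambda\omega(\xi)}|D^\alpha\hat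 u(\xi)|<\infty$, where $D^\alpha=D_1^{\alpha_1}\cdots D_d^{\alpha_d}$, $D_j=-i\partial_{x_j}$. For $f,\psi\in\mathcal S_\omega(\mathbb R^d)$ let $$V_\psi f(x,\xi)=\int_{\mathbb R^d}f(y)\overline{\psi(y-x)}e^{-i\langle y,\xi\rangle}\,dy,\qquad x,\xi\in\mathbb R^d .$$ For $p,q\in[1,\infty]$ and measurable $F$ on $\mathbb R^{2d}$ let $$\|F\|_{L^{p,q}}=\Big(\int_{\mathbb R^d}\Big(\int_{\mathbb R^d}|F(x,\xi)|^p\,dx\Big)^{q/p}d\xi\Big)^{1/q}\in[0,\infty],$$ with the $L^p$ or $L^q$ norm replaced by the essential supremum if $p=\infty$ or $q=\infty$. For a function $g$ on $\mathbb R^d$ let $R_g=\sup\{|x|_\infty:x\in\operatorname{supp}g\}\in[0,\infty]$, with $\sup\emptyset=0$. Let $f\in\mathcal S_\omega(\mathbb R^d)$, $\tilde f(x)=f(-x)$, and $p,q\in[1,\infty]$. Then for all $\lambda,\mu\ge0$ $$\lim_{N\to\infty}\Big\|e^{\lambda\omega\left(\frac{x}{N+1}\right)+\mu\omega(\xi)}\,|\xi|_\infty^N\,V_{\tilde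 f}f(x,\xi)\Big\|_{L^{p,q}}^{1/N}=2R_{\hat f},$$ where both sides may be $+\infty$. In particular, $$\limsup_{N\to\infty}\Big\|e^{\lambda\omega\left(\frac{x}{N+1}\right)+\mu\omega(\xi)}\,|\xi|_\infty^N\,V_{\tilde f}f(x,\xi)\Big\|_{L^{p,q}}^{1/N}=R_{\hat f}+R_{\hat{\tilde f}}.$$ -/

import Mathlib

open Filter Topology MeasureTheory
open scoped ENNReal ComplexConjugate

noncomputable section

namespace UltraPW

/-- The Euclidean space `ℝ^d` (with Euclidean norm, inner product and Lebesgue measure). -/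
abbrev Rd (d : ℕ) : Type := EuclideanSpace ℝ (Fin d)

/-- Non-quasianalytic weight functions `ω : [0,∞) → [0,∞)`. A weight is represented by a function
on `ℝ` of which only the restriction to `[0,∞)` is used. -/
structure IsWeight (ω : ℝ → ℝ) : Prop where
  nonneg : ∀ t, 0 ≤ t → 0 ≤ ω t
  continuousOn : ContinuousOn ω (Set.Ici 0)
  monotoneOn : MonotoneOn ω (Set.Ici 0)
  /-- condition (α) -/
  doubling : ∃ L : ℝ, 1 ≤ L ∧ ∀ t, 0 ≤ t → ω (2 * t) ≤ L * (ω t + 1)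
  /-- condition (β) -/
  integrable : IntegrableOn (fun t => ω t / t ^ 2) (Set.Ioi 1)
  /-- condition (γ) -/
  log_le : ∃ a b : ℝ, 0 < b ∧ ∀ t, 0 ≤ t → a + b * Real.log (1 + t) ≤ ω t
  /-- condition (δ) -/
  convex : ConvexOn ℝ Set.univ (fun t => ω (Real.exp t))

variable {d : ℕ}

/-- The sup norm `|x|_∞` of a vector of `ℝ^d`. -/
def supNorm (x : Rd d) : ℝ := ‖WithLp.ofLp x‖

/-- `D_j = -i ∂_{x_j}`. -/
def pD (j : Fin d) (u : Rd d → ℂ) : Rd d → ℂ :=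
  fun x => -Complex.I * lineDeriv ℝ u x (EuclideanSpace.single j 1)

/-- `D^α = D_1^{α_1} ⋯ D_d^{α_d}`. -/
def multiD (α : Fin d → ℕ) (u : Rd d → ℂ) : Rd d → ℂ :=
  (List.finRange d).foldr (fun j g => (pD j)^[α j] g) u

/-- The Fourier transform `û(ξ) = ∫ u(x) e^{-i⟨x,ξ⟩} dx`. -/
def fourierT (u : Rd d → ℂ) (ξ : Rd d) : ℂ :=
  ∫ x, u x * Complex.exp (-Complex.I * (inner ℝ x ξ : ℝ))

/-- The space `S_ω(ℝ^d)`. -/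
structure IsSomega (ω : ℝ → ℝ) (u : Rd d → ℂ) : Prop where
  integrable : Integrable u
  smooth : ContDiff ℝ ((⊤ : ℕ∞) : WithTop ℕ∞) u
  smooth_fourier : ContDiff ℝ ((⊤ : ℕ∞) : WithTop ℕ∞) (fourierT u)
  decay : ∀ lam : ℝ, 0 < lam → ∀ α : Fin d → ℕ,
    BddAbove (Set.range fun x => Real.exp (lam * ω ‖x‖) * ‖multiD α u x‖)
  decay_fourier : ∀ lam : ℝ, 0 < lam → ∀ α : Fin d → ℕ,
    BddAbove (Set.range fun ξ => Real.exp (lam * ω ‖ξ‖) * ‖multiD α (fourierT u) ξ‖)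

/-- The Gabor transform `V_ψ u(x,ξ) = ∫ u(y) conj(ψ(y-x)) e^{-i⟨y,ξ⟩} dy`. -/
def gabor (ψ u : Rd d → ℂ) (x ξ : Rd d) : ℂ :=
  ∫ y, u y * conj (ψ (y - x)) * Complex.exp (-Complex.I * (inner ℝ y ξ : ℝ))

/-- The reflection `f̃(x) = f(-x)`. -/
def refl (f : Rd d → ℂ) : Rd d → ℂ := fun x => f (-x)

/-- The mixed norm of `L^{p,q}(ℝ^{2d})`, with value `∞` off the space: the `L^p` norm in the first
variable, then the `L^q` norm in the second. -/
def mixedNorm (p q : ℝ≥0∞) (F : Rd d → Rd d → ℂ) : ℝ≥0∞ :=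
  eLpNorm (fun ξ => eLpNorm (fun x => F x ξ) p volume) q volume

/-- `R_g = sup {|x|_∞ : x ∈ supp g} ∈ [0,∞]`, with `sup ∅ = 0`. -/
def radius (g : Rd d → ℂ) : ℝ≥0∞ := ⨆ x ∈ tsupport g, ENNReal.ofReal (supNorm x)

/-- `e^{λ ω(x/(N+1)) + μ ω(ξ)} |ξ|_∞^N V_ψ f(x,ξ)`. -/
def weightedGabor (ω : ℝ → ℝ) (lam mu : ℝ) (ψ f : Rd d → ℂ) (N : ℕ) (x ξ : Rd d) : ℂ :=
  ((Real.exp (lam * ω ‖((N : ℝ) + 1)⁻¹ • x‖ + mu * ω ‖ξ‖) * supNorm ξ ^ N : ℝ) : ℂ) * gabor ψ f x ξ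

end UltraPW

end

/-! For fixed ξ, the function x ↦ V(x,ξ) = ∫ f(y) conj(f(x-y)) e^{-i⟨y,ξ⟩} dy is a twisted
convolution, and its Fourier transform at η is f̂(ξ+η) conj(f̂(-η)) (`fourierT_gabor_refl`). If this
is nonzero, then ξ = (ξ+η) + (-η) is a sum of two points of supp f̂, so V(·,ξ) = 0 once |ξ|_∞ > 2R.
At ξ = 2η₀, η = -η₀ it equals |f̂(η₀)|², so the bound 2R is sharp.

Hence, for finite R, the mixed norm is at most (2R)^N K: ξ stays in a bounded set, and ω(x/(N+1)) ≤
ω(x) makes the decay in x uniform in N. For r < 2R it is at least r^N K with K > 0, by restricting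
to a product of open sets where |V| > c > 0 and |ξ|_∞ > r. The N-th root removes K. -/

namespace UltraPW

open scoped FourierTransform Convolution

/-! ### Fourier transform: normalization, injectivity, reflection -/

section Character

variable {d : ℕ}

theorem norm_exp_neg_I_mul (t : ℝ) : ‖Complex.exp (-Complex.I * (t : ℂ))‖ = 1 := by
  simp [Complex.norm_exp]

theorem integrable_mul_char {f : Rd d → ℂ} (hf : Integrable f) (ξ : Rd d) :
    Integrable fun y => f y * Complex.exp (-Complex.I * (inner ℝ y ξ : ℝ)) := by
  refine hf.mul_bdd (c := 1) (Continuous.aestronglyMeasurable (by fun_prop)) ?_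
  exact Eventually.of_forall fun y => (norm_exp_neg_I_mul _).le

theorem fourierT_eq_fourier (u : Rd d → ℂ) (ξ : Rd d) :
    fourierT u ((2 * Real.pi) • ξ) = 𝓕 u ξ := by
  rw [Real.fourier_eq', fourierT]
  congr 1
  ext y
  rw [smul_eq_mul, mul_comm, inner_smul_right]
  congr 2
  push_cast
  ring

/-- Injectivity of the Fourier transform on continuous integrable functions. -/
theorem eq_zero_of_fourierT_eq_zero {u : Rd d → ℂ} (hc : Continuous u) (hi : Integrable u)
    (h : ∀ ξ, fourierT u ξ = 0) : u = 0 := by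
  have h0 : 𝓕 u = 0 := by
    ext ξ
    rw [← fourierT_eq_fourier, h, Pi.zero_apply]
  have h1 := hc.fourierInv_fourier_eq hi (by rw [h0]; exact integrable_zero _ _ _)
  rw [← h1, h0]
  ext x
  simp [Real.fourierInv_eq']

theorem fourierT_refl (f : Rd d → ℂ) (ξ : Rd d) : fourierT (refl f) ξ = fourierT f (-ξ) := by
  rw [fourierT, fourierT, ← integral_neg_eq_self]
  simp [refl]

end Character

/-! ### Sup norm and radius of the support -/

section Radius

variable {d : ℕ}

theorem continuous_supNorm : Continuous (supNorm : Rd d → ℝ) :=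
  (PiLp.continuous_ofLp 2 _).norm

theorem supNorm_nonneg (x : Rd d) : 0 ≤ supNorm x := norm_nonneg _

theorem supNorm_add_le (x y : Rd d) : supNorm (x + y) ≤ supNorm x + supNorm y :=
  norm_add_le _ _

theorem supNorm_two_smul (x : Rd d) : supNorm ((2 : ℝ) • x) = 2 * supNorm x := by
  simp [supNorm, norm_smul]

theorem supNorm_neg (x : Rd d) : supNorm (-x) = supNorm x := norm_neg _

theorem radius_comp_neg (g : Rd d → ℂ) : radius (fun x => g (-x)) = radius g := by
  have h : tsupport (fun x => g (-x)) = Neg.neg ⁻¹' tsupport g :=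
    tsupport_comp_eq_preimage g (Homeomorph.neg (Rd d))
  unfold radius
  rw [h]
  refine le_antisymm (iSup₂_le fun x hx => ?_) (iSup₂_le fun x hx => ?_)
  · rw [← supNorm_neg]
    exact le_iSup₂ (f := fun x (_ : x ∈ tsupport g) => ENNReal.ofReal (supNorm x)) (-x) hx
  · rw [← supNorm_neg]
    exact le_iSup₂ (f := fun x (_ : x ∈ Neg.neg ⁻¹' tsupport g) => ENNReal.ofReal (supNorm x))
      (-x) (by simpa using hx)

theorem ofReal_supNorm_le_radius {g : Rd d → ℂ} {x : Rd d} (hx : g x ≠ 0) :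
    ENNReal.ofReal (supNorm x) ≤ radius g :=
  le_iSup₂ (f := fun x (_ : x ∈ tsupport g) => ENNReal.ofReal (supNorm x)) x
    (subset_tsupport g hx)

/-- The set |x|_∞ > r is open, so a point of the closed support lying in it can be moved to one
where g itself does not vanish. -/
theorem exists_ne_zero_of_lt_radius {g : Rd d → ℂ} {r : ℝ≥0∞} (hr : r < radius g) :
    ∃ x, g x ≠ 0 ∧ r < ENNReal.ofReal (supNorm x) := by
  obtain ⟨x, hx⟩ := lt_iSup_iff.1 hr
  obtain ⟨hx, hrx⟩ := lt_iSup_iff.1 hx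
  have ho : IsOpen {x : Rd d | r < ENNReal.ofReal (supNorm x)} :=
    isOpen_lt continuous_const (ENNReal.continuous_ofReal.comp continuous_supNorm)
  obtain ⟨y, hy, hgy⟩ := mem_closure_iff.1 hx _ ho hrx
  exact ⟨y, hgy, hy⟩

end Radius

/-! ### Gabor transform with reflected window, and its support in ξ -/

section Gabor

variable {d : ℕ}

theorem gabor_refl (f : Rd d → ℂ) (x ξ : Rd d) :
    gabor (refl f) f x ξ =
      ∫ y, f y * conj (f (x - y)) * Complex.exp (-Complex.I * (inner ℝ y ξ : ℝ)) := by
  simp [gabor, refl]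

/-- The phases regroup as ⟨y,ξ⟩ + ⟨x,η⟩ = ⟨y,ξ+η⟩ + ⟨x-y,η⟩. Integrating over x then gives the
Fourier transform of V(·,ξ) as a product. -/
theorem gabor_refl_mul_char (f : Rd d → ℂ) (x ξ η : Rd d) :
    gabor (refl f) f x ξ * Complex.exp (-Complex.I * (inner ℝ x η : ℝ)) =
      ((fun y => f y * Complex.exp (-Complex.I * (inner ℝ y (ξ + η) : ℝ)))
        ⋆[ContinuousLinearMap.mul ℝ ℂ]
        fun y => conj (f y) * Complex.exp (-Complex.I * (inner ℝ y η : ℝ))) x := by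
  rw [gabor_refl, ← integral_mul_const, convolution]
  congr 1
  ext y
  simp only [ContinuousLinearMap.mul_apply']
  have : Complex.exp (-Complex.I * (inner ℝ y ξ : ℝ)) *
      Complex.exp (-Complex.I * (inner ℝ x η : ℝ)) =
      Complex.exp (-Complex.I * (inner ℝ y (ξ + η) : ℝ)) *
      Complex.exp (-Complex.I * (inner ℝ (x - y) η : ℝ)) := by
    rw [← Complex.exp_add, ← Complex.exp_add, inner_add_right, inner_sub_left]
    push_cast
    congr 1
    ring
  linear_combination f y * conj (f (x - y)) * this

theorem integrable_conj {f : Rd d → ℂ} (hf : Integrable f) : Integrable fun y => conj (f y) :=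
  Complex.conjCLE.toContinuousLinearMap.integrable_comp hf

theorem fourierT_conj (f : Rd d → ℂ) (η : Rd d) :
    fourierT (fun y => conj (f y)) η = conj (fourierT f (-η)) := by
  rw [fourierT, fourierT, ← integral_conj]
  congr 1
  ext y
  simp [← Complex.exp_conj]

theorem integrable_gabor_refl {f : Rd d → ℂ} (hf : Integrable f) (ξ : Rd d) :
    Integrable fun x => gabor (refl f) f x ξ := by
  have h := (integrable_mul_char hf (ξ + 0)).integrable_convolution
    (ContinuousLinearMap.mul ℝ ℂ) (integrable_mul_char (integrable_conj hf) 0)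
  refine h.congr (Eventually.of_forall fun x => ?_)
  dsimp only
  rw [← gabor_refl_mul_char]
  simp

theorem fourierT_gabor_refl {f : Rd d → ℂ} (hf : Integrable f) (ξ η : Rd d) :
    fourierT (fun x => gabor (refl f) f x ξ) η =
      fourierT f (ξ + η) * conj (fourierT f (-η)) := by
  have h := integral_convolution (ContinuousLinearMap.mul ℝ ℂ)
    (integrable_mul_char hf (ξ + η)) (integrable_mul_char (integrable_conj hf) η)
  rw [ContinuousLinearMap.mul_apply'] at h
  rw [← fourierT_conj]
  refine Eq.trans ?_ h
  rw [fourierT]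
  congr 1
  ext x
  exact gabor_refl_mul_char f x ξ η

theorem continuous_gabor_refl {f : Rd d → ℂ} (hf : Integrable f) (hc : Continuous f) {C : ℝ}
    (hC : ∀ x, ‖f x‖ ≤ C) :
    Continuous fun z : Rd d × Rd d => gabor (refl f) f z.1 z.2 := by
  simp only [gabor_refl]
  refine continuous_of_dominated (bound := fun y => ‖f y‖ * C) (fun z => ?_) (fun z => ?_)
    (hf.norm.mul_const C) ?_
  · have h : Continuous fun y => conj (f (z.1 - y)) :=
      Complex.continuous_conj.comp (hc.comp (by fun_prop))
    exact Continuous.aestronglyMeasurable ((hc.mul h).mul (by fun_prop))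
  · refine Eventually.of_forall fun y => ?_
    rw [norm_mul, norm_mul, norm_exp_neg_I_mul, mul_one, RCLike.norm_conj]
    exact mul_le_mul_of_nonneg_left (hC _) (norm_nonneg _)
  · refine Eventually.of_forall fun y => ?_
    have h : Continuous fun z : Rd d × Rd d => conj (f (z.1 - y)) :=
      Complex.continuous_conj.comp (hc.comp (by fun_prop))
    exact (continuous_const.mul h).mul (by fun_prop)

theorem gabor_refl_eq_zero {f : Rd d → ℂ} (hf : Integrable f) (hc : Continuous f) {C : ℝ}
    (hC : ∀ x, ‖f x‖ ≤ C) {ξ : Rd d}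
    (hξ : 2 * radius (fourierT f) < ENNReal.ofReal (supNorm ξ)) (x : Rd d) :
    gabor (refl f) f x ξ = 0 := by
  have hpair : Continuous fun x : Rd d => (x, ξ) := continuous_id.prodMk continuous_const
  have hcont : Continuous fun x => gabor (refl f) f x ξ := by
    have h := (continuous_gabor_refl hf hc hC).comp hpair
    simpa only [Function.comp_def] using h
  refine congrFun (eq_zero_of_fourierT_eq_zero hcont (integrable_gabor_refl hf ξ) fun η => ?_) x
  rw [fourierT_gabor_refl hf]
  by_contra hne
  obtain ⟨h1, h2⟩ := mul_ne_zero_iff.1 hne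
  have h1 := ofReal_supNorm_le_radius h1
  have h2 := ofReal_supNorm_le_radius ((map_ne_zero _).1 h2)
  have h3 : supNorm ξ ≤ supNorm (ξ + η) + supNorm (-η) := by
    simpa using supNorm_add_le (ξ + η) (-η)
  refine absurd hξ (not_lt.2 ((ENNReal.ofReal_le_ofReal h3).trans ?_))
  rw [ENNReal.ofReal_add (supNorm_nonneg _) (supNorm_nonneg _), two_mul]
  exact add_le_add h1 h2

theorem exists_gabor_refl_ne_zero {f : Rd d → ℂ} (hf : Integrable f) {η : Rd d}
    (hη : fourierT f η ≠ 0) : ∃ x, gabor (refl f) f x ((2 : ℝ) • η) ≠ 0 := by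
  by_contra! h
  have h1 := fourierT_gabor_refl hf ((2 : ℝ) • η) (-η)
  have h2 : (2 : ℝ) • η + -η = η := by module
  rw [h2, neg_neg] at h1
  have h3 : fourierT (fun x => gabor (refl f) f x ((2 : ℝ) • η)) (-η) = 0 := by
    simp [fourierT, h]
  rw [h3] at h1
  exact mul_ne_zero hη ((map_ne_zero _).2 hη) h1.symm

end Gabor

/-! ### Weighted decay of the Gabor transform in x, uniform in ξ -/

section Decay

variable {d : ℕ} {ω : ℝ → ℝ}

/-- Since |y+z| is at most twice the larger norm, monotonicity and one doubling suffice. -/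
theorem IsWeight.le_add (hω : IsWeight ω) {L : ℝ}
    (hL : ∀ t, 0 ≤ t → ω (2 * t) ≤ L * (ω t + 1)) (hL1 : 1 ≤ L) (y z : Rd d) :
    ω ‖y + z‖ ≤ L * (ω ‖y‖ + ω ‖z‖ + 1) := by
  have key : ∀ a b : ℝ, 0 ≤ a → a ≤ b → ∀ c, 0 ≤ c → c ≤ a + b →
      ω c ≤ L * (ω a + ω b + 1) := by
    intro a b ha hab c hc hcab
    have h1 : ω c ≤ ω (2 * b) :=
      hω.monotoneOn hc (by simp only [Set.mem_Ici]; linarith) (by linarith)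
    have h2 := hL b (ha.trans hab)
    have h3 := hω.nonneg a ha
    nlinarith
  rcases le_total ‖y‖ ‖z‖ with h | h
  · exact key _ _ (norm_nonneg _) h _ (norm_nonneg _) (norm_add_le _ _)
  · rw [add_comm (ω ‖y‖)]
    exact key _ _ (norm_nonneg _) h _ (norm_nonneg _) (by rw [add_comm y]; exact norm_add_le _ _)

theorem IsSomega.exists_bound {f : Rd d → ℂ} (hf : IsSomega ω f) {lam : ℝ} (hlam : 0 < lam) :
    ∃ C, 0 ≤ C ∧ ∀ x, Real.exp (lam * ω ‖x‖) * ‖f x‖ ≤ C := by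
  obtain ⟨C, hC⟩ := hf.decay lam hlam 0
  have hD : multiD 0 f = f := by
    have : ∀ l : List (Fin d),
        l.foldr (fun j g => (pD j)^[(0 : Fin d → ℕ) j] g) f = f := by
      intro l
      induction l with
      | nil => rfl
      | cons a l ih => simp
    exact this _
  rw [hD] at hC
  have hC' : ∀ x, Real.exp (lam * ω ‖x‖) * ‖f x‖ ≤ C := fun x => hC ⟨x, rfl⟩
  exact ⟨C, le_trans (by positivity) (hC' 0), hC'⟩

theorem IsSomega.exists_norm_le (hω : IsWeight ω) {f : Rd d → ℂ} (hf : IsSomega ω f) :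
    ∃ C, ∀ x, ‖f x‖ ≤ C := by
  obtain ⟨C, -, hC⟩ := hf.exists_bound one_pos
  refine ⟨C, fun x => le_trans ?_ (hC x)⟩
  refine le_mul_of_one_le_left (norm_nonneg _) (Real.one_le_exp ?_)
  rw [one_mul]
  exact hω.nonneg _ (norm_nonneg _)

/-- Exponentials of a weight dominate any power. -/
theorem IsWeight.exists_exp_le (hω : IsWeight ω) (r : ℝ) (hr : 0 < r) :
    ∃ κ C : ℝ, 0 < κ ∧ 0 < C ∧
      ∀ t, 0 ≤ t → Real.exp (-(κ * ω t)) ≤ C * (1 + t) ^ (-r) := by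
  obtain ⟨a, b, hb, hab⟩ := hω.log_le
  refine ⟨r / b, Real.exp (-(r / b * a)), by positivity, Real.exp_pos _, fun t ht => ?_⟩
  rw [Real.rpow_def_of_pos (by linarith), ← Real.exp_add]
  refine Real.exp_le_exp.2 ?_
  have h := mul_le_mul_of_nonneg_left (hab t ht) (by positivity : 0 ≤ r / b)
  have h' : r / b * (a + b * Real.log (1 + t)) = r / b * a + r * Real.log (1 + t) := by
    field_simp
  linarith

theorem exists_weight_mul_gabor_le (hω : IsWeight ω) {f : Rd d → ℂ} (hf : IsSomega ω f) {lam : ℝ}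
    (hlam : 0 ≤ lam) :
    ∃ K, 0 ≤ K ∧ ∀ x ξ, Real.exp (lam * ω ‖x‖) * ‖gabor (refl f) f x ξ‖ ≤
      K * (1 + ‖x‖) ^ (-((d : ℝ) + 1)) := by
  obtain ⟨L, hL1, hL⟩ := hω.doubling
  obtain ⟨κ, D, hκ, hD, hdec⟩ := hω.exists_exp_le ((d : ℝ) + 1) (by positivity)
  -- The factor L pays for splitting ω(x) between y and x-y; κ is spent at the end on decay in x.
  -- The second bound, with m + κ, has a further κ to make the y-integral converge.
  obtain ⟨m, hm⟩ : ∃ m, m = (lam + κ) * L := ⟨_, rfl⟩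
  have hm0 : 0 < m := by rw [hm]; positivity
  obtain ⟨C, hC0, hC⟩ := hf.exists_bound hm0
  obtain ⟨C', hC0', hC'⟩ := hf.exists_bound (add_pos hm0 hκ)
  have hint : Integrable fun y : Rd d => (1 + ‖y‖) ^ (-((d : ℝ) + 1)) :=
    integrable_one_add_norm (by simp)
  set J := ∫ y : Rd d, (1 + ‖y‖) ^ (-((d : ℝ) + 1))
  have hJ : 0 ≤ J := integral_nonneg fun y => by positivity
  have hb : ∀ x ξ, Real.exp ((lam + κ) * ω ‖x‖) * ‖gabor (refl f) f x ξ‖ ≤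
      Real.exp m * C' * D * C * J := by
    intro x ξ
    rw [gabor_refl]
    have h1 : Real.exp ((lam + κ) * ω ‖x‖) *
        ‖∫ y, f y * conj (f (x - y)) * Complex.exp (-Complex.I * (inner ℝ y ξ : ℝ))‖ =
        ‖∫ y, (Real.exp ((lam + κ) * ω ‖x‖) : ℂ) *
          (f y * conj (f (x - y)) * Complex.exp (-Complex.I * (inner ℝ y ξ : ℝ)))‖ := by
      rw [integral_const_mul, norm_mul, Complex.norm_real, Real.norm_eq_abs, Real.abs_exp]
    rw [h1, ← integral_const_mul]
    refine norm_integral_le_of_norm_le (hint.const_mul _) (Eventually.of_forall fun y => ?_)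
    rw [norm_mul, norm_mul, norm_mul, norm_exp_neg_I_mul, mul_one, RCLike.norm_conj,
      Complex.norm_real, Real.norm_eq_abs, Real.abs_exp]
    have e1 : Real.exp ((lam + κ) * ω ‖x‖) ≤
        Real.exp m * (Real.exp (m * ω ‖y‖) * Real.exp (m * ω ‖x - y‖)) := by
      rw [← Real.exp_add, ← Real.exp_add]
      refine Real.exp_le_exp.2 ?_
      have h := hω.le_add hL hL1 y (x - y)
      rw [add_sub_cancel] at h
      have h' := mul_le_mul_of_nonneg_left h (by positivity : 0 ≤ lam + κ)
      rw [hm]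
      linarith
    have e2 : Real.exp (m * ω ‖y‖) * ‖f y‖ ≤ C' * (D * (1 + ‖y‖) ^ (-((d : ℝ) + 1))) := by
      have h : Real.exp (m * ω ‖y‖) * ‖f y‖ =
          Real.exp ((m + κ) * ω ‖y‖) * ‖f y‖ * Real.exp (-(κ * ω ‖y‖)) := by
        rw [mul_right_comm, ← Real.exp_add]
        congr 2
        ring
      rw [h]
      exact mul_le_mul (hC' y) (hdec _ (norm_nonneg _)) (Real.exp_pos _).le hC0'
    calc _ ≤ Real.exp m * (Real.exp (m * ω ‖y‖) * Real.exp (m * ω ‖x - y‖)) *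
          (‖f y‖ * ‖f (x - y)‖) := mul_le_mul_of_nonneg_right e1 (by positivity)
      _ = Real.exp m * ((Real.exp (m * ω ‖y‖) * ‖f y‖) *
          (Real.exp (m * ω ‖x - y‖) * ‖f (x - y)‖)) := by ring
      _ ≤ Real.exp m * ((C' * (D * (1 + ‖y‖) ^ (-((d : ℝ) + 1)))) * C) := by
          refine mul_le_mul_of_nonneg_left ?_ (Real.exp_pos _).le
          exact mul_le_mul e2 (hC _) (by positivity) (by positivity)
      _ = _ := by ring
  refine ⟨Real.exp m * C' * D * C * J * D, by positivity, fun x ξ => ?_⟩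
  have h : Real.exp (lam * ω ‖x‖) * ‖gabor (refl f) f x ξ‖ =
      Real.exp ((lam + κ) * ω ‖x‖) * ‖gabor (refl f) f x ξ‖ * Real.exp (-(κ * ω ‖x‖)) := by
    rw [mul_right_comm, ← Real.exp_add]
    congr 2
    ring
  rw [h, mul_assoc _ D]
  exact mul_le_mul (hb x ξ) (hdec _ (norm_nonneg _)) (Real.exp_pos _).le (by positivity)

end Decay

/-! ### Two-sided estimates of the mixed norm -/

section MixedNorm

variable {d : ℕ}

theorem eLpNorm_one_add_norm_lt_top {p : ℝ≥0∞} (hp : 1 ≤ p) :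
    eLpNorm (fun x : Rd d => (1 + ‖x‖) ^ (-((d : ℝ) + 1))) p volume < ∞ := by
  have hm : AEStronglyMeasurable (fun x : Rd d => (1 + ‖x‖) ^ (-((d : ℝ) + 1))) volume :=
    (Measurable.aestronglyMeasurable (by fun_prop))
  rcases eq_or_ne p ∞ with rfl | hpt
  · refine (memLp_top_of_bound hm 1 (Eventually.of_forall fun x => ?_)).2
    rw [Real.norm_of_nonneg (by positivity)]
    exact Real.rpow_le_one_of_one_le_of_nonpos (by linarith [norm_nonneg x])
      (by linarith [(Nat.cast_nonneg d : (0 : ℝ) ≤ d)])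
  · have hp0 : p ≠ 0 := (zero_lt_one.trans_le hp).ne'
    have hp1 : 1 ≤ p.toReal := by
      simpa using ENNReal.toReal_mono hpt hp
    refine ((integrable_norm_rpow_iff hm hp0 hpt).1 ?_).2
    have : (fun x : Rd d => ‖(1 + ‖x‖) ^ (-((d : ℝ) + 1))‖ ^ p.toReal) =
        fun x => (1 + ‖x‖) ^ (-(((d : ℝ) + 1) * p.toReal)) := by
      ext x
      rw [Real.norm_of_nonneg (by positivity), ← Real.rpow_mul (by positivity), neg_mul]
    rw [this]
    refine integrable_one_add_norm ?_
    rw [finrank_euclideanSpace, Fintype.card_fin]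
    nlinarith [(Nat.cast_nonneg d : (0 : ℝ) ≤ d)]

/-- For p = ∞ the exponent is 1/0 = 0, so the volume factor is 1 and the formula still holds. -/
theorem eLpNorm_indicator_const_pos {s : Set (Rd d)} (hs : IsOpen s) (hne : s.Nonempty)
    {p : ℝ≥0∞} (hp : 1 ≤ p) (a : ℝ≥0∞) :
    eLpNorm (s.indicator fun _ => a) p volume = a * volume s ^ (1 / p.toReal) ∧
      volume s ^ (1 / p.toReal) ≠ 0 := by
  have hv : volume s ≠ 0 := (hs.measure_pos volume hne).ne'
  refine ⟨?_, ?_⟩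
  · rw [eLpNorm_indicator_const' hs.measurableSet hv (zero_lt_one.trans_le hp).ne']
    rfl
  · simp [ENNReal.rpow_eq_zero_iff, hv]

theorem mul_le_mixedNorm {p q : ℝ≥0∞} (hp : 1 ≤ p) (hq : 1 ≤ q) {F : Rd d → Rd d → ℂ}
    {U W : Set (Rd d)} (hU : IsOpen U) (hUn : U.Nonempty) (hW : IsOpen W) (hWn : W.Nonempty)
    {a : ℝ≥0∞} (h : ∀ x ∈ U, ∀ ξ ∈ W, a ≤ ‖F x ξ‖ₑ) :
    a * volume U ^ (1 / p.toReal) * volume W ^ (1 / q.toReal) ≤ mixedNorm p q F := by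
  rw [← (eLpNorm_indicator_const_pos hW hWn hq _).1, mixedNorm]
  refine eLpNorm_mono_enorm fun ξ => ?_
  by_cases hξ : ξ ∈ W
  · rw [Set.indicator_of_mem hξ, ← (eLpNorm_indicator_const_pos hU hUn hp _).1]
    refine eLpNorm_mono_enorm fun x => ?_
    by_cases hx : x ∈ U
    · rw [Set.indicator_of_mem hx]
      exact h x hx ξ hξ
    · rw [Set.indicator_of_notMem hx]
      simp
  · rw [Set.indicator_of_notMem hξ]
    simp

theorem mixedNorm_le {p q : ℝ≥0∞} {F : Rd d → Rd d → ℂ} {h : Rd d → ℝ} {W : Set (Rd d)} {a : ℝ}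
    (hF : ∀ x, ∀ ξ ∈ W, ‖F x ξ‖ ≤ a * ‖h x‖) (h0 : ∀ x, ∀ ξ ∉ W, F x ξ = 0) :
    mixedNorm p q F ≤ ENNReal.ofReal a * (eLpNorm h p volume * volume W ^ (1 / q.toReal)) := by
  rw [← mul_assoc]
  refine le_trans ?_ (eLpNorm_indicator_const_le (ENNReal.ofReal a * eLpNorm h p volume) q)
  refine eLpNorm_mono_enorm fun ξ => ?_
  by_cases hξ : ξ ∈ W
  · rw [Set.indicator_of_mem hξ]
    exact eLpNorm_le_mul_eLpNorm_of_ae_le_mul (Eventually.of_forall fun x => hF x ξ hξ) p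
  · rw [Set.indicator_of_notMem hξ]
    simp [h0 _ ξ hξ]

end MixedNorm

/-! ### N-th roots of geometric bounds -/

section Limit

theorem tendsto_rpow_one_div {K : ℝ≥0∞} (h0 : K ≠ 0) (ht : K ≠ ∞) :
    Tendsto (fun N : ℕ => K ^ (1 / (N : ℝ))) atTop (𝓝 1) := by
  have h := (tendsto_one_div_atTop_nhds_zero_nat (𝕜 := ℝ))
  lift K to NNReal using ht
  have h0 : K ≠ 0 := by simpa using h0
  have h1 : Tendsto (fun N : ℕ => K ^ (1 / (N : ℝ))) atTop (𝓝 (K ^ (0 : ℝ))) :=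
    tendsto_const_nhds.nnrpow h (Or.inl h0)
  rw [NNReal.rpow_zero] at h1
  simp only [← ENNReal.coe_rpow_of_ne_zero h0]
  exact ENNReal.tendsto_coe.2 h1

theorem eventually_lt_rpow {u : ℕ → ℝ≥0∞} {K r a : ℝ≥0∞} (hK : K ≠ 0) (har : a < r)
    (h : ∀ N, r ^ N * K ≤ u N) : ∀ᶠ N : ℕ in atTop, a < u N ^ (1 / (N : ℝ)) := by
  -- K may be ∞, as the open sets may have infinite volume; truncating at 1 makes its N-th root tend
  -- to 1.
  have hK1 : min K 1 ≠ 0 := by simp [hK]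
  have hlim : Tendsto (fun N : ℕ => r * (min K 1) ^ (1 / (N : ℝ))) atTop (𝓝 (r * 1)) :=
    ENNReal.Tendsto.const_mul
      (tendsto_rpow_one_div hK1 ((min_le_right _ _).trans_lt ENNReal.one_lt_top).ne)
      (Or.inl one_ne_zero)
  rw [mul_one] at hlim
  filter_upwards [hlim.eventually_const_lt har, eventually_ge_atTop 1] with N hN hN1
  refine hN.trans_le ?_
  have h1 : r ^ N * min K 1 ≤ u N := (mul_le_mul_right (min_le_left _ _) _).trans (h N)
  refine le_trans (le_of_eq ?_) (ENNReal.rpow_le_rpow h1 (by positivity))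
  rw [ENNReal.mul_rpow_of_nonneg _ _ (by positivity), ← ENNReal.rpow_natCast, ← ENNReal.rpow_mul,
    mul_one_div_cancel (by positivity), ENNReal.rpow_one]

theorem eventually_rpow_lt {u : ℕ → ℝ≥0∞} {K r b : ℝ≥0∞} (hK : K ≠ ∞) (hrb : r < b)
    (h : ∀ N, u N ≤ r ^ N * K) : ∀ᶠ N : ℕ in atTop, u N ^ (1 / (N : ℝ)) < b := by
  have hK1 : max K 1 ≠ 0 := by simp
  have hlim : Tendsto (fun N : ℕ => r * (max K 1) ^ (1 / (N : ℝ))) atTop (𝓝 (r * 1)) :=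
    ENNReal.Tendsto.const_mul
      (tendsto_rpow_one_div hK1 (max_lt hK.lt_top ENNReal.one_lt_top).ne) (Or.inl one_ne_zero)
  rw [mul_one] at hlim
  filter_upwards [hlim.eventually_lt_const hrb, eventually_ge_atTop 1] with N hN hN1
  refine lt_of_le_of_lt ?_ hN
  have h1 : u N ≤ r ^ N * max K 1 := (h N).trans (mul_le_mul_right (le_max_left _ _) _)
  refine (ENNReal.rpow_le_rpow h1 (by positivity)).trans (le_of_eq ?_)
  rw [ENNReal.mul_rpow_of_nonneg _ _ (by positivity), ← ENNReal.rpow_natCast, ← ENNReal.rpow_mul,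
    mul_one_div_cancel (by positivity), ENNReal.rpow_one]

end Limit

theorem exists_isOpen_forall_lt {X Y : Type*} [TopologicalSpace X] [TopologicalSpace Y]
    {G : X → Y → ℝ} (hG : Continuous fun z : X × Y => G z.1 z.2) {c : ℝ} {x₀ : X} {y₀ : Y}
    (hc : c < G x₀ y₀) :
    ∃ (U : Set X) (W : Set Y), IsOpen U ∧ x₀ ∈ U ∧ IsOpen W ∧ y₀ ∈ W ∧
      ∀ x ∈ U, ∀ y ∈ W, c < G x y := by
  obtain ⟨U, W, hU, hW, hxU, hyW, hUW⟩ :=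
    isOpen_prod_iff.1 (isOpen_lt continuous_const hG) x₀ y₀ hc
  exact ⟨U, W, hU, hxU, hW, hyW, fun x hx y hy => hUW (Set.mk_mem_prod hx hy)⟩

/-! ### Lower and upper geometric bounds for the weighted norm -/

section WeightedGabor

variable {d : ℕ} {ω : ℝ → ℝ} {f : Rd d → ℂ} {lam mu : ℝ}

theorem norm_weightedGabor (ψ f : Rd d → ℂ) (N : ℕ) (x ξ : Rd d) :
    ‖weightedGabor ω lam mu ψ f N x ξ‖ =
      Real.exp (lam * ω ‖((N : ℝ) + 1)⁻¹ • x‖ + mu * ω ‖ξ‖) * supNorm ξ ^ N *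
        ‖gabor ψ f x ξ‖ := by
  rw [weightedGabor, norm_mul, Complex.norm_real, Real.norm_of_nonneg]
  exact mul_nonneg (Real.exp_pos _).le (pow_nonneg (supNorm_nonneg _) _)

theorem exists_pow_mul_le_mixedNorm (hω : IsWeight ω) (hf : IsSomega ω f) {p q : ℝ≥0∞}
    (hp : 1 ≤ p) (hq : 1 ≤ q) (hlam : 0 ≤ lam) (hmu : 0 ≤ mu) {r : ℝ≥0∞}
    (hr : r < 2 * radius (fourierT f)) :
    ∃ K ≠ 0, ∀ N, r ^ N * K ≤ mixedNorm p q (weightedGabor ω lam mu (refl f) f N) := by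
  obtain ⟨C, hC⟩ := hf.exists_norm_le hω
  obtain ⟨η, hη, hrη⟩ := exists_ne_zero_of_lt_radius
    (ENNReal.div_lt_of_lt_mul' hr : r / 2 < radius (fourierT f))
  have hrη' : r < ENNReal.ofReal (supNorm ((2 : ℝ) • η)) := by
    rw [supNorm_two_smul, ENNReal.ofReal_mul zero_le_two, ENNReal.ofReal_ofNat, mul_comm]
    exact (ENNReal.div_lt_iff (by simp) (by simp)).1 hrη
  obtain ⟨x₀, hx₀⟩ := exists_gabor_refl_ne_zero hf.integrable hη
  have hcont := continuous_gabor_refl hf.integrable hf.smooth.continuous hC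
  obtain ⟨c, hc0, hc⟩ := exists_between (norm_pos_iff.2 hx₀)
  obtain ⟨U, W, hU, hxU, hW, hηW, hUW⟩ : ∃ U W : Set (Rd d), IsOpen U ∧ x₀ ∈ U ∧ IsOpen W ∧
      (2 : ℝ) • η ∈ W ∧ ∀ x ∈ U, ∀ ξ ∈ W, c < ‖gabor (refl f) f x ξ‖ := by
    exact exists_isOpen_forall_lt (G := fun x ξ => ‖gabor (refl f) f x ξ‖) hcont.norm hc
  have hW' : IsOpen (W ∩ {ξ | r < ENNReal.ofReal (supNorm ξ)}) :=
    hW.inter (isOpen_lt continuous_const (ENNReal.continuous_ofReal.comp continuous_supNorm))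
  have hWn : (W ∩ {ξ | r < ENNReal.ofReal (supNorm ξ)}).Nonempty := ⟨_, hηW, hrη'⟩
  have hUn : U.Nonempty := ⟨_, hxU⟩
  refine ⟨ENNReal.ofReal c * volume U ^ (1 / p.toReal) *
    volume (W ∩ {ξ | r < ENNReal.ofReal (supNorm ξ)}) ^ (1 / q.toReal),
    mul_ne_zero (mul_ne_zero (by simpa using hc0) (eLpNorm_indicator_const_pos hU hUn hp 1).2)
      (eLpNorm_indicator_const_pos hW' hWn hq 1).2, fun N => ?_⟩
  rw [← mul_assoc, ← mul_assoc]
  refine mul_le_mixedNorm hp hq hU hUn hW' hWn fun x hx ξ hξ => ?_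
  have h1 : c < ‖gabor (refl f) f x ξ‖ := hUW x hx ξ hξ.1
  have h2 : 1 ≤ Real.exp (lam * ω ‖((N : ℝ) + 1)⁻¹ • x‖ + mu * ω ‖ξ‖) :=
    Real.one_le_exp (add_nonneg (mul_nonneg hlam (hω.nonneg _ (norm_nonneg _)))
      (mul_nonneg hmu (hω.nonneg _ (norm_nonneg _))))
  have h3 : supNorm ξ ^ N * c ≤ ‖weightedGabor ω lam mu (refl f) f N x ξ‖ := by
    rw [norm_weightedGabor]
    have := pow_nonneg (supNorm_nonneg ξ) N
    exact mul_le_mul (le_mul_of_one_le_left this h2) h1.le hc0.le (by positivity)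
  rw [← ofReal_norm]
  refine le_trans ?_ (ENNReal.ofReal_le_ofReal h3)
  rw [ENNReal.ofReal_mul (pow_nonneg (supNorm_nonneg ξ) N), ENNReal.ofReal_pow (supNorm_nonneg ξ)]
  gcongr
  exact hξ.2.le

theorem exists_mixedNorm_le_pow_mul (hω : IsWeight ω) (hf : IsSomega ω f) {p q : ℝ≥0∞}
    (hp : 1 ≤ p) (hlam : 0 ≤ lam) (hmu : 0 ≤ mu) (hR : radius (fourierT f) ≠ ∞) :
    ∃ K ≠ ∞, ∀ N, mixedNorm p q (weightedGabor ω lam mu (refl f) f N) ≤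
      (2 * radius (fourierT f)) ^ N * K := by
  obtain ⟨C, hC⟩ := hf.exists_norm_le hω
  obtain ⟨K, hK0, hK⟩ := exists_weight_mul_gabor_le hω hf hlam
  set R : ℝ := (2 * radius (fourierT f)).toReal with hRdef
  have hRtop : 2 * radius (fourierT f) ≠ ∞ := ENNReal.mul_ne_top (by simp) hR
  have hRof : 2 * radius (fourierT f) = ENNReal.ofReal R := (ENNReal.ofReal_toReal hRtop).symm
  have hR0 : 0 ≤ R := ENNReal.toReal_nonneg
  set W : Set (Rd d) := {ξ | supNorm ξ ≤ R} with hWdef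
  have hWb : Bornology.IsBounded W := by
    have := (PiLp.antilipschitzWith_ofLp 2 (fun _ : Fin d => ℝ)).isBounded_preimage
      (Metric.isBounded_closedBall (x := (0 : Fin d → ℝ)) (r := R))
    refine this.subset fun ξ hξ => ?_
    simpa [hWdef, supNorm] using hξ
  obtain ⟨B, hB⟩ := hWb.exists_norm_le
  -- B may be negative when W is empty, and ω is monotone only on [0,∞).
  set M : ℝ := Real.exp (mu * ω (max B 0)) with hM
  refine ⟨ENNReal.ofReal (M * K) *
    (eLpNorm (fun x : Rd d => (1 + ‖x‖) ^ (-((d : ℝ) + 1))) p volume *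
      volume W ^ (1 / q.toReal)), ?_, fun N => ?_⟩
  · refine ENNReal.mul_ne_top ENNReal.ofReal_ne_top (ENNReal.mul_ne_top
      (eLpNorm_one_add_norm_lt_top hp).ne (ENNReal.rpow_ne_top_of_nonneg (by positivity) ?_))
    exact hWb.measure_lt_top.ne
  rw [hRof, ← ENNReal.ofReal_pow hR0, ← mul_assoc, ← ENNReal.ofReal_mul (pow_nonneg hR0 N)]
  refine mixedNorm_le (fun x ξ hξ => ?_) fun x ξ hξ => ?_
  · rw [norm_weightedGabor, Real.norm_of_nonneg (by positivity)]
    have e1 : ω ‖((N : ℝ) + 1)⁻¹ • x‖ ≤ ω ‖x‖ := by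
      refine hω.monotoneOn (norm_nonneg _) (norm_nonneg _) ?_
      rw [norm_smul, Real.norm_of_nonneg (by positivity)]
      exact mul_le_of_le_one_left (norm_nonneg _)
        (inv_le_one_of_one_le₀ (by linarith [(Nat.cast_nonneg N : (0 : ℝ) ≤ N)]))
    have e2 : ω ‖ξ‖ ≤ ω (max B 0) :=
      hω.monotoneOn (norm_nonneg _) (le_max_right B 0) ((hB ξ hξ).trans (le_max_left _ _))
    have e3 : Real.exp (lam * ω ‖((N : ℝ) + 1)⁻¹ • x‖ + mu * ω ‖ξ‖) ≤
        M * Real.exp (lam * ω ‖x‖) := by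
      rw [hM, ← Real.exp_add]
      refine Real.exp_le_exp.2 ?_
      have := mul_le_mul_of_nonneg_left e1 hlam
      have := mul_le_mul_of_nonneg_left e2 hmu
      linarith
    have e4 : supNorm ξ ^ N ≤ R ^ N := pow_le_pow_left₀ (supNorm_nonneg ξ) hξ N
    have e5 := pow_nonneg (supNorm_nonneg ξ) N
    calc _ ≤ M * Real.exp (lam * ω ‖x‖) * R ^ N * ‖gabor (refl f) f x ξ‖ := by gcongr
      _ = R ^ N * M * (Real.exp (lam * ω ‖x‖) * ‖gabor (refl f) f x ξ‖) := by ring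
      _ ≤ R ^ N * M * (K * (1 + ‖x‖) ^ (-((d : ℝ) + 1))) :=
        mul_le_mul_of_nonneg_left (hK x ξ) (by positivity)
      _ = _ := by ring
  · have h : 2 * radius (fourierT f) < ENNReal.ofReal (supNorm ξ) := by
      rw [hRof]
      exact (ENNReal.ofReal_lt_ofReal_iff_of_nonneg hR0).2 (not_le.1 hξ)
    rw [weightedGabor, gabor_refl_eq_zero hf.integrable hf.smooth.continuous hC h, mul_zero]

end WeightedGabor

end UltraPW

theorem proposition3p9 (d : ℕ) (ω : ℝ → ℝ) (hω : UltraPW.IsWeight ω)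
    (f : UltraPW.Rd d → ℂ) (hf : UltraPW.IsSomega ω f)
    (p q : ℝ≥0∞) (hp : 1 ≤ p) (hq : 1 ≤ q)
    (lam mu : ℝ) (hlam : 0 ≤ lam) (hmu : 0 ≤ mu) :
    Tendsto
      (fun N : ℕ =>
        UltraPW.mixedNorm p q (UltraPW.weightedGabor ω lam mu (UltraPW.refl f) f N) ^ (1 / (N : ℝ)))
      atTop (𝓝 (2 * UltraPW.radius (UltraPW.fourierT f))) ∧
    limsup
      (fun N : ℕ =>
        UltraPW.mixedNorm p q (UltraPW.weightedGabor ω lam mu (UltraPW.refl f) f N) ^ (1 / (N : ℝ)))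
      atTop =
      UltraPW.radius (UltraPW.fourierT f) +
        UltraPW.radius (UltraPW.fourierT (UltraPW.refl f)) := by
  have hlim : Tendsto
      (fun N : ℕ =>
        UltraPW.mixedNorm p q (UltraPW.weightedGabor ω lam mu (UltraPW.refl f) f N) ^ (1 / (N : ℝ)))
      atTop (𝓝 (2 * UltraPW.radius (UltraPW.fourierT f))) := by
    refine tendsto_order.2 ⟨fun a ha => ?_, fun b hb => ?_⟩
    · obtain ⟨r, har, hr⟩ := exists_between ha
      obtain ⟨K, hK, h⟩ := UltraPW.exists_pow_mul_le_mixedNorm hω hf hp hq hlam hmu hr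
      exact UltraPW.eventually_lt_rpow hK har h
    -- The upper estimate is only needed when some b exceeds 2R, which forces R to be finite.
    · have hR : UltraPW.radius (UltraPW.fourierT f) ≠ ∞ := by
        intro h
        simp [h] at hb
      obtain ⟨K, hK, h⟩ := UltraPW.exists_mixedNorm_le_pow_mul (q := q) hω hf hp hlam hmu hR
      exact UltraPW.eventually_rpow_lt hK hb h
  refine ⟨hlim, ?_⟩
  have hrefl : UltraPW.fourierT (UltraPW.refl f) = fun ξ => UltraPW.fourierT f (-ξ) :=
    funext (UltraPW.fourierT_refl f)
  rw [hlim.limsup_eq, hrefl, UltraPW.radius_comp_neg, two_mul]
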